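/- A mesh pattern of length $k$ is a pair $(\tau,R)$ with $\tau\in S_k$ and $R\subseteq\{0,\dots,k\}^2$. An occurrence of $(\tau,R)$ in a permutation $\pi\in S_n$ is a sequence of positions $1\le i_1<\dots<i_k\le n$ such that $\pi(i_1),\dots,\pi(i_k)$ are in the same relative order as $\tau(1),\dots,\tau(k)$ and such that, writing $j_1<\dots<j_k$ for these values in increasing order and $i_0=j_0=0$, $i_{k+1}=j_{k+1}=n+1$, for every $(a,b)\in R$ there is no $\ell$ with $i_a<\ell<i_{a+1}$ and $j_b<\pi(\ell)<j_{b+1}$. The permutation $\pi$ avoids the pattern if there is no occurrence; $S_n(p)$ denotes the set of permutations in $S_n$ that avoid $p$. An adjacent transposition of a permutation is a $2$-cycle $(i,i+1)$ in its disjoint cycle decomposition. Let $a_2(n,0)$ be the number of permutations of $\{1,\dots,n\}$ that have no adjacent transposition. Corollary (Conjecture 3.14 of Claesson, 2022). Let $p=(132,R)$ with $$R=\{(0,2),(0,3),(1,2),(1,3),(2,0),(2,1),(2,2),(2,3),(3,1),(3,2)\}.$$ Let $F(x)=\sum_{m\ge 0}m!\,x^m$. Then, as formal power series, $$\sum_{n\ge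 0}|S_n(p)|\,x^n=F\!\left(\frac{x}{1+x^2}\right)=\sum_{m\ge 0}m!\left(\frac{x}{1+x^2}\right)^m .$$ Moreover, $|S_n(p)|=a_2(n,0)+a_2(n-2,0)$ for all $n\ge 2$. -/

import Mathlib

/-- A mesh pattern `(τ, R)` of length `k`: a permutation `τ` of `{0, …, k-1}` (position `m` carries
the value `τ m`) together with a set `R` of shaded boxes `(a, b)` with `0 ≤ a, b ≤ k`. In the usual
drawing, in which the points are `(m + 1, τ m + 1)`, the box `(a, b)` is the unit square with lower
left corner `(a, b)`. -/
structure MeshPattern (k : ℕ) where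
  perm : Equiv.Perm (Fin k)
  shaded : Finset (Fin (k + 1) × Fin (k + 1))

namespace MeshPattern

variable {k n : ℕ}

/-- The entry of `π` at position `l` lies in the open region corresponding to the box `(a, b)`, when
the points of the pattern are placed at the positions `f`: exactly the first `a` pattern points
(by position) lie to the left of it, the others to the right, and exactly the `b` smallest pattern
points (by value) lie below it, the others above. -/
def InBox (p : MeshPattern k) (π : Equiv.Perm (Fin n)) (f : Fin k ↪o Fin n)
    (a b : Fin (k + 1)) (l : Fin n) : Prop :=
  (∀ m : Fin k, (m.val < a.val → f m < l) ∧ (a.val ≤ m.val → l < f m)) ∧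
  (∀ m : Fin k, ((p.perm m).val < b.val → π (f m) < π l) ∧
    (b.val ≤ (p.perm m).val → π l < π (f m)))

/-- The increasing sequence of positions `f` is an occurrence of the mesh pattern `p` in `π`: the
entries at these positions are in the same relative order as the underlying permutation of `p`, and
no entry of `π` lies in a shaded region. -/
def IsOccurrence (p : MeshPattern k) (π : Equiv.Perm (Fin n)) (f : Fin k ↪o Fin n) : Prop :=
  (∀ m m' : Fin k, π (f m) < π (f m') ↔ p.perm m < p.perm m') ∧
  (∀ c ∈ p.shaded, ∀ l : Fin n, ¬ p.InBox π f c.1 c.2 l)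

/-- The set `S_n(p)` of the permutations of an `n`-element chain that avoid the mesh pattern `p`. -/
def avoiders (p : MeshPattern k) (n : ℕ) : Set (Equiv.Perm (Fin n)) :=
  {π | ∀ f : Fin k ↪o Fin n, ¬ p.IsOccurrence π f}

end MeshPattern

/-- The mesh pattern with underlying permutation `132` and its ten shaded boxes. -/
def meshPatternP : MeshPattern 3 where
  perm := Equiv.swap 1 2
  shaded := {(0, 2), (0, 3), (1, 2), (1, 3), (2, 0), (2, 1), (2, 2), (2, 3), (3, 1), (3, 2)}

/-- For `q ≥ 1`: the elements `i, i + 1, …, i + q - 1` all lie in the ground set `{0, …, n-1}`, and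
`(i, i + 1, …, i + q - 1)` is a cycle of `π`. -/
def IsAdjacentCycle (q : ℕ) {n : ℕ} (π : Equiv.Perm (Fin n)) (i : Fin n) : Prop :=
  i.val + q ≤ n ∧
  ∀ j < q, ∀ x : Fin n, x.val = i.val + j → (π x).val = i.val + (j + 1) % q

/-- `a_q(n, k)`: the number of permutations of an `n`-element chain with exactly `k` adjacent
`q`-cycles, for `q ≥ 1`. -/
noncomputable def adjacentCycleCount (q n k : ℕ) : ℕ :=
  {π : Equiv.Perm (Fin n) | {i : Fin n | IsAdjacentCycle q π i}.ncard = k}.ncard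

/-- The formal power series `∑ n! x^n`. -/
def factorialSeries : PowerSeries ℚ :=
  PowerSeries.mk fun n => (Nat.factorial n : ℚ)

/-- The formal power series `x / (1 + x^2)`. -/
noncomputable def xDivOneAddSq : PowerSeries ℚ :=
  PowerSeries.X * (1 + PowerSeries.X ^ 2)⁻¹

theorem xDivOneAddSq_mul : xDivOneAddSq * (1 + PowerSeries.X ^ 2) = PowerSeries.X := by
  rw [xDivOneAddSq, mul_assoc, PowerSeries.inv_mul_cancel _ (by simp), mul_one]

theorem hasSubst_xDivOneAddSq : PowerSeries.HasSubst xDivOneAddSq :=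
  PowerSeries.HasSubst.of_constantCoeff_zero' (by simp [xDivOneAddSq])

/-! An occurrence of the pattern forces a tight descent: at some position `i > 0` stand `v + 1, v`,
where `v` is the least number exceeding every earlier entry. Conversely, a tight descent together
with the largest earlier entry is an occurrence (`mem_avoiders_meshPatternP_iff`).

Tight descents and adjacent transpositions obey the same two rules. Sites `i` and `i + 1` cannot
both be occupied, and deleting the two entries of an occupied site `i` is a bijection onto all
permutations of size `n - 2` that keeps the sites `j` with `j + 1 < i`. These rules alone determine
the number of permutations with no occupied site, as an alternating sum over sparse sets of sites
(`ncard_avoiding_eq_sparseSum`).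

Transpositions have `n - 1` sites, tight descents `n - 2`, since position `0` is excluded. One step
of Pascal's rule (`sparseSum_succ`) therefore relates the two counts, and expanding `(1 + X ^ 2)⁻¹ ^
m` yields the same sum for the series. -/

/-! ### Insertion and deletion of entries -/

/-- The permutation obtained from `σ` by inserting a new entry `v` at position `i`. -/
def insertEntry {n : ℕ} (σ : Equiv.Perm (Fin n)) (i v : Fin (n + 1)) : Equiv.Perm (Fin (n + 1)) :=
  (finSuccEquiv' i).trans ((Equiv.optionCongr σ).trans (finSuccEquiv' v).symm)

section Insertion

variable {n : ℕ}

@[simp] theorem insertEntry_self (σ : Equiv.Perm (Fin n)) (i v : Fin (n + 1)) :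
    insertEntry σ i v i = v := by
  simp [insertEntry]

@[simp] theorem insertEntry_succAbove (σ : Equiv.Perm (Fin n)) (i v : Fin (n + 1)) (k : Fin n) :
    insertEntry σ i v (i.succAbove k) = v.succAbove (σ k) := by
  simp [insertEntry]

theorem insertEntry_injective (i v : Fin (n + 1)) :
    Function.Injective fun σ : Equiv.Perm (Fin n) => insertEntry σ i v := by
  intro σ τ h
  ext1 k
  have := congrArg (fun π : Equiv.Perm (Fin (n + 1)) => π (i.succAbove k)) h
  simpa using this

theorem exists_insertEntry_eq (π : Equiv.Perm (Fin (n + 1))) {i v : Fin (n + 1)} (h : π i = v) :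
    ∃ σ, insertEntry σ i v = π := by
  have hne : ∀ k, ∃ l, v.succAbove l = π (i.succAbove k) := fun k =>
    Fin.exists_succAbove_eq fun e => Fin.succAbove_ne i k (π.injective (e.trans h.symm))
  choose g hg using hne
  have hinj : Function.Injective g := fun a b hab =>
    Fin.succAbove_right_injective (π.injective ((hg a).symm.trans ((congrArg _ hab).trans (hg b))))
  refine ⟨Equiv.ofBijective g (Finite.injective_iff_bijective.1 hinj), ?_⟩
  ext1 x
  rcases Fin.eq_self_or_eq_succAbove i x with rfl | ⟨k, rfl⟩
  · simp [h]
  · simp [hg]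

/-- The permutation obtained from `σ` by inserting the two entries `v + 1, v` at the positions
`i, i + 1`. -/
def insertDescent (σ : Equiv.Perm (Fin n)) {i v : ℕ} (hi : i ≤ n) (hv : v ≤ n) :
    Equiv.Perm (Fin (n + 2)) :=
  insertEntry (insertEntry σ ⟨i, by omega⟩ ⟨v, by omega⟩) ⟨i, by omega⟩ ⟨v + 1, by omega⟩

variable {i v : ℕ}

theorem insertDescent_left (σ : Equiv.Perm (Fin n)) (hi : i ≤ n) (hv : v ≤ n) (h : i < n + 2) :
    (insertDescent σ hi hv ⟨i, h⟩).val = v + 1 := by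
  simp [insertDescent]

theorem insertDescent_right (σ : Equiv.Perm (Fin n)) (hi : i ≤ n) (hv : v ≤ n)
    (h : i + 1 < n + 2) : (insertDescent σ hi hv ⟨i + 1, h⟩).val = v := by
  have e : (⟨i + 1, h⟩ : Fin (n + 2)) =
      Fin.succAbove ⟨i, by omega⟩ (⟨i, by omega⟩ : Fin (n + 1)) := by
    ext; simp [Fin.succAbove]
  rw [e, insertDescent, insertEntry_succAbove, insertEntry_self]
  simp [Fin.succAbove, Fin.lt_def]

theorem insertDescent_of_lt (σ : Equiv.Perm (Fin n)) (hi : i ≤ n) (hv : v ≤ n) {k : ℕ}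
    (hk : k < i) : (insertDescent σ hi hv ⟨k, by omega⟩).val =
      if (σ ⟨k, by omega⟩).val < v then (σ ⟨k, by omega⟩).val else (σ ⟨k, by omega⟩).val + 2 := by
  have e : (⟨k, by omega⟩ : Fin (n + 2)) = Fin.succAbove ⟨i, by omega⟩
      (Fin.succAbove ⟨i, by omega⟩ (⟨k, by omega⟩ : Fin n)) := by
    ext; simp [Fin.succAbove, Fin.lt_def, hk]
  rw [e, insertDescent, insertEntry_succAbove, insertEntry_succAbove]
  simp only [Fin.succAbove, Fin.lt_def, Fin.val_castSucc]
  split_ifs <;> simp_all <;> omega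

theorem insertDescent_injective (hi : i ≤ n) (hv : v ≤ n) :
    Function.Injective fun σ : Equiv.Perm (Fin n) => insertDescent σ hi hv :=
  (insertEntry_injective _ _).comp (insertEntry_injective _ _)

theorem exists_insertDescent_eq (π : Equiv.Perm (Fin (n + 2))) (hi : i ≤ n) (hv : v ≤ n)
    (hl : (π ⟨i, by omega⟩).val = v + 1) (hr : (π ⟨i + 1, by omega⟩).val = v) :
    ∃ σ, insertDescent σ hi hv = π := by
  obtain ⟨ρ, hρ⟩ := exists_insertEntry_eq π (i := ⟨i, by omega⟩) (v := ⟨v + 1, by omega⟩)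
    (Fin.ext hl)
  have e : (⟨i + 1, by omega⟩ : Fin (n + 2)) =
      Fin.succAbove ⟨i, by omega⟩ (⟨i, by omega⟩ : Fin (n + 1)) := by
    ext; simp [Fin.succAbove]
  have hρi : ρ ⟨i, by omega⟩ = ⟨v, by omega⟩ := by
    rw [e, ← hρ, insertEntry_succAbove] at hr
    have e' : (⟨v, by omega⟩ : Fin (n + 2)) =
        Fin.succAbove ⟨v + 1, by omega⟩ (⟨v, by omega⟩ : Fin (n + 1)) := by
      ext; simp [Fin.succAbove]
    exact Fin.succAbove_right_injective ((Fin.ext hr).trans e')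
  obtain ⟨σ, hσ⟩ := exists_insertEntry_eq ρ hρi
  exact ⟨σ, by rw [insertDescent, hσ, hρ]⟩

end Insertion

/-! ### Counting by sparse sets of sites -/

/-- `∑ (-1)^j N_j (n - 2j)!` where `N_j = (k - j).choose j` is the number of ways to choose `j`
pairwise non-consecutive elements among `k - 1` consecutive integers. -/
def sparseSum (n k : ℕ) : ℤ :=
  ∑ j ∈ Finset.range (n / 2 + 1), (-1) ^ j * ((k - j).choose j : ℤ) * ((n - 2 * j).factorial : ℤ)

theorem sparseSum_of_le_one (n : ℕ) {k : ℕ} (hk : k ≤ 1) : sparseSum n k = n.factorial := by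
  rw [sparseSum, Finset.sum_range_succ', Finset.sum_eq_zero]
  · simp
  · intro j _
    rw [Nat.choose_eq_zero_of_lt (by omega)]
    simp

theorem choose_sub_succ (k j : ℕ) :
    (k + 2 - (j + 1)).choose (j + 1) = (k + 1 - (j + 1)).choose (j + 1) + (k - j).choose j := by
  rcases le_or_gt j k with h | h
  · rw [show k + 2 - (j + 1) = k - j + 1 by omega, show k + 1 - (j + 1) = k - j by omega,
      Nat.choose_succ_succ', add_comm]
  · rw [Nat.choose_eq_zero_of_lt (by omega), Nat.choose_eq_zero_of_lt (by omega),
      Nat.choose_eq_zero_of_lt (by omega)]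

theorem sparseSum_succ (n k : ℕ) :
    sparseSum (n + 2) (k + 2) = sparseSum (n + 2) (k + 1) - sparseSum n k := by
  simp only [sparseSum]
  rw [show (n + 2) / 2 + 1 = n / 2 + 1 + 1 by omega, Finset.sum_range_succ',
    Finset.sum_range_succ' _ (n / 2 + 1), add_sub_right_comm, ← Finset.sum_sub_distrib]
  congr 1
  · refine Finset.sum_congr rfl fun j _ => ?_
    rw [choose_sub_succ, show n + 2 - 2 * (j + 1) = n - 2 * j by omega]
    push_cast
    ring

/-- Induction on the number `k` of sites `s, …, s + k - 1`: permutations avoiding all but the last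
site either avoid it too, or arise from size `n - 2` by insertion there. This is the recursion of
`sparseSum_succ`. -/
theorem ncard_avoiding_eq_sparseSum (P : ∀ n : ℕ, Equiv.Perm (Fin n) → ℕ → Prop) (s : ℕ)
    (hcons : ∀ n π i, P n π i → ¬ P n π (i + 1))
    (hins : ∀ n i, s ≤ i → i ≤ n → ∃ g : Equiv.Perm (Fin n) → Equiv.Perm (Fin (n + 2)),
      Function.Injective g ∧ Set.range g = {π | P (n + 2) π i} ∧
      ∀ σ j, j + 1 < i → (P (n + 2) (g σ) j ↔ P n σ j)) (k n : ℕ) (hk : s + k + 1 ≤ n ∨ k = 0) :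
    ({π | ∀ i, s ≤ i → i < s + k → ¬ P n π i}.ncard : ℤ) = sparseSum n (k + 1) := by
  have key : ∀ m, ({π | ∀ i, s ≤ i → i < s + 0 → ¬ P m π i}.ncard : ℤ) = m.factorial := by
    intro m
    have : {π | ∀ i, s ≤ i → i < s + 0 → ¬ P m π i} = Set.univ :=
      Set.eq_univ_of_forall fun π i h1 h2 => absurd h1 (by omega)
    rw [this, Set.ncard_univ, Nat.card_perm, Nat.card_fin]
  induction k using Nat.strong_induction_on generalizing n with
  | _ k ih =>
  rcases k with _ | k
  · rw [key, sparseSum_of_le_one _ (by simp)]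
  obtain ⟨n, rfl⟩ : ∃ m, n = m + 2 := ⟨n - 2, by omega⟩
  obtain ⟨g, hg, hrange, hlt⟩ := hins n (s + k) (by omega) (by omega)
  -- An occupied site `s + k` already excludes `s + k - 1`, so only `k - 1` sites remain to be
  -- avoided after deletion. For `k = 0` the subtraction truncates harmlessly: both sides are `n!`.
  have hdel : ({σ | ∀ i, s ≤ i → i < s + (k - 1) → ¬ P n σ i}.ncard : ℤ) = sparseSum n k := by
    rcases k with _ | k
    · rw [key, sparseSum_of_le_one _ (by simp)]
    · exact ih k (by omega) n (by omega)
  have hsplit : {π | ∀ i, s ≤ i → i < s + k → ¬ P (n + 2) π i} =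
      {π | ∀ i, s ≤ i → i < s + (k + 1) → ¬ P (n + 2) π i} ∪
        g '' {σ | ∀ i, s ≤ i → i < s + (k - 1) → ¬ P n σ i} := by
    ext π
    constructor
    · intro h
      by_cases hP : P (n + 2) π (s + k)
      · right
        obtain ⟨σ, rfl⟩ : π ∈ Set.range g := hrange ▸ hP
        exact ⟨σ, fun i h1 h2 h3 => h i h1 (by omega) ((hlt σ i (by omega)).2 h3), rfl⟩
      · left
        intro i h1 h2
        rcases eq_or_ne i (s + k) with rfl | hne
        · exact hP
        · exact h i h1 (by omega)
    · rintro (h | ⟨σ, h, rfl⟩) i h1 h2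
      · exact h i h1 (by omega)
      · have hP : P (n + 2) (g σ) (s + k) := by
          have : g σ ∈ Set.range g := ⟨σ, rfl⟩
          rwa [hrange] at this
        rcases eq_or_ne (i + 1) (s + k) with hi | hi
        · exact fun h3 => hcons _ _ _ h3 (hi ▸ hP)
        · exact fun h3 => h i h1 (by omega) ((hlt σ i (by omega)).1 h3)
  have hdisj : Disjoint {π | ∀ i, s ≤ i → i < s + (k + 1) → ¬ P (n + 2) π i}
      (g '' {σ | ∀ i, s ≤ i → i < s + (k - 1) → ¬ P n σ i}) := by
    rw [Set.disjoint_left]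
    rintro _ h ⟨σ, -, rfl⟩
    have : g σ ∈ Set.range g := ⟨σ, rfl⟩
    rw [hrange] at this
    exact h (s + k) (by omega) (by omega) this
  have hcard := congrArg (fun S => (S.ncard : ℤ)) hsplit
  simp only [Set.ncard_union_eq hdisj, Set.ncard_image_of_injective _ hg, Nat.cast_add] at hcard
  rw [hdel, ih k (by omega) (n + 2) (by omega)] at hcard
  rw [sparseSum_succ]
  linarith

/-! ### Adjacent transpositions -/

/-- The entries at the positions `i, i + 1` are interchanged by `π`. -/
def SwapsAt (n : ℕ) (π : Equiv.Perm (Fin n)) (i : ℕ) : Prop :=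
  ∃ h : i + 1 < n, (π ⟨i, by omega⟩).val = i + 1 ∧ (π ⟨i + 1, h⟩).val = i

theorem isAdjacentCycle_two_iff {n : ℕ} (π : Equiv.Perm (Fin n)) (i : Fin n) :
    IsAdjacentCycle 2 π i ↔ SwapsAt n π i := by
  constructor
  · rintro ⟨h, h'⟩
    exact ⟨by omega, h' 0 (by simp) _ (by simp), h' 1 (by simp) ⟨i + 1, by omega⟩ (by simp)⟩
  · rintro ⟨h, h0, h1⟩
    refine ⟨by omega, fun j hj x hx => ?_⟩
    interval_cases j
    · obtain rfl : x = i := Fin.ext (by simpa using hx)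
      simpa using h0
    · obtain rfl : x = ⟨i + 1, h⟩ := Fin.ext (by simpa using hx)
      simpa using h1

theorem adjacentCycleCount_two_zero (n : ℕ) :
    (adjacentCycleCount 2 n 0 : ℤ) = sparseSum n n := by
  have hmain := ncard_avoiding_eq_sparseSum SwapsAt 0
    (fun n π i h h' => by
      obtain ⟨_, _, h⟩ := h
      obtain ⟨_, h', _⟩ := h'
      omega)
    (fun n i _ hi => by
      refine ⟨fun σ => insertDescent σ hi hi, insertDescent_injective hi hi, ?_, ?_⟩
      · ext π
        constructor
        · rintro ⟨σ, rfl⟩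
          exact ⟨by omega, insertDescent_left σ hi hi _, insertDescent_right σ hi hi _⟩
        · rintro ⟨_, h1, h2⟩
          exact exists_insertDescent_eq π hi hi h1 h2
      · intro σ j hj
        have h1 := insertDescent_of_lt σ hi hi (k := j) (by omega)
        have h2 := insertDescent_of_lt σ hi hi (k := j + 1) (by omega)
        simp only [SwapsAt, h1, h2]
        constructor
        · rintro ⟨_, h3, h4⟩
          refine ⟨by omega, ?_, ?_⟩
          · split_ifs at h3 <;> omega
          · split_ifs at h4 <;> omega
        · rintro ⟨_, h3, h4⟩
          refine ⟨by omega, ?_, ?_⟩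
          · split_ifs <;> omega
          · split_ifs <;> omega) (n - 1) n (by omega)
  have hset : {π : Equiv.Perm (Fin n) | {i : Fin n | IsAdjacentCycle 2 π i}.ncard = 0} =
      {π | ∀ i, 0 ≤ i → i < 0 + (n - 1) → ¬ SwapsAt n π i} := by
    ext π
    simp only [Set.mem_ofPred_eq, Set.ncard_eq_zero (Set.toFinite _), Set.eq_empty_iff_forall_notMem,
      isAdjacentCycle_two_iff]
    exact ⟨fun h i _ hi => h ⟨i, by omega⟩, fun h i hi => h i (by omega) (by have := hi.1; omega) hi⟩
  rw [adjacentCycleCount, hset, hmain]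
  rcases n with _ | n
  · simp [sparseSum_of_le_one]
  · simp

/-! ### Tight descents -/

/-- The smallest number that exceeds all entries of `π` at positions `< i`. -/
def prefixBound {n : ℕ} (π : Equiv.Perm (Fin n)) (i : ℕ) : ℕ :=
  (Finset.univ.filter fun k : Fin n => k.val < i).sup fun k => (π k).val + 1

section PrefixBound

variable {n : ℕ} (π : Equiv.Perm (Fin n)) {i : ℕ}

theorem prefixBound_le_iff {v : ℕ} :
    prefixBound π i ≤ v ↔ ∀ k : Fin n, k.val < i → (π k).val < v := by
  simp [prefixBound, Finset.sup_le_iff]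

theorem lt_prefixBound {k : Fin n} (hk : k.val < i) : (π k).val < prefixBound π i :=
  (prefixBound_le_iff π).1 le_rfl k hk

theorem prefixBound_le : prefixBound π i ≤ n :=
  (prefixBound_le_iff π).2 fun k _ => (π k).isLt

theorem exists_add_one_eq_prefixBound (hi : 0 < i) (hn : 0 < n) :
    ∃ k : Fin n, k.val < i ∧ (π k).val + 1 = prefixBound π i := by
  obtain ⟨k, hk, h⟩ := Finset.exists_mem_eq_sup (Finset.univ.filter fun k : Fin n => k.val < i)
    ⟨⟨0, hn⟩, by simpa using hi⟩ fun k => (π k).val + 1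
  exact ⟨k, by simpa using hk, h.symm⟩

end PrefixBound

theorem prefixBound_congr {n m : ℕ} (π : Equiv.Perm (Fin n)) (σ : Equiv.Perm (Fin m)) {i : ℕ}
    (hn : i ≤ n) (hm : i ≤ m)
    (h : ∀ k (hk : k < i), (π ⟨k, by omega⟩).val = (σ ⟨k, by omega⟩).val) :
    prefixBound π i = prefixBound σ i := by
  refine eq_of_forall_ge_iff fun v => ?_
  rw [prefixBound_le_iff, prefixBound_le_iff]
  constructor
  · intro H k hk
    have := H ⟨k, by omega⟩ hk
    rwa [h k hk] at this
  · intro H k hk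
    have := H ⟨k, by omega⟩ hk
    rwa [← h k hk] at this

/-- The entries at the positions `i, i + 1` are `v + 1, v`, where `v` is the smallest number that
exceeds all entries before them. -/
def HasTightDescentAt (n : ℕ) (π : Equiv.Perm (Fin n)) (i : ℕ) : Prop :=
  ∃ h : i + 1 < n, (π ⟨i, by omega⟩).val = prefixBound π i + 1 ∧
    (π ⟨i + 1, h⟩).val = prefixBound π i

theorem insertDescent_prefixBound_of_lt {n i : ℕ} (σ : Equiv.Perm (Fin n)) (hi : i ≤ n) {k : ℕ}
    (hk : k < i) : (insertDescent σ hi (prefixBound_le σ (i := i)) ⟨k, by omega⟩).val =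
      (σ ⟨k, by omega⟩).val := by
  rw [insertDescent_of_lt σ hi _ hk, if_pos (lt_prefixBound σ hk)]

theorem prefixBound_insertDescent {n i j : ℕ} (σ : Equiv.Perm (Fin n)) (hi : i ≤ n) (hj : j ≤ i) :
    prefixBound (insertDescent σ hi (prefixBound_le σ (i := i))) j = prefixBound σ j :=
  prefixBound_congr _ _ (by omega) (by omega) fun _ hk =>
    insertDescent_prefixBound_of_lt σ hi (by omega)

theorem ncard_not_hasTightDescentAt (n : ℕ) :
    ({π | ∀ i, 0 < i → ¬ HasTightDescentAt n π i}.ncard : ℤ) = sparseSum n (n - 1) := by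
  have hmain := ncard_avoiding_eq_sparseSum HasTightDescentAt 1
    (fun n π i h h' => by
      obtain ⟨_, h1, h2⟩ := h
      obtain ⟨_, h3, _⟩ := h'
      have := lt_prefixBound π (i := i + 1) (k := ⟨i, by omega⟩) (by simp)
      omega)
    (fun n i _ hi => by
      refine ⟨fun σ => insertDescent σ hi (prefixBound_le σ (i := i)), ?_, ?_, ?_⟩
      -- The inserted value depends on `σ`, but the result determines it, because the entries before
      -- position `i` are unchanged.
      · intro σ τ h
        have hb := congrArg (fun π => prefixBound π i) h
        simp only [prefixBound_insertDescent _ hi le_rfl] at hb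
        simp only [hb] at h
        exact insertDescent_injective hi _ h
      · ext π
        constructor
        · rintro ⟨σ, rfl⟩
          refine ⟨by omega, ?_⟩
          simp only [prefixBound_insertDescent _ hi le_rfl]
          exact ⟨insertDescent_left σ hi _ _, insertDescent_right σ hi _ _⟩
        · rintro ⟨h, h1, h2⟩
          have hv : prefixBound π i ≤ n := by
            have := (π ⟨i, by omega⟩).isLt
            omega
          obtain ⟨σ, hσ⟩ := exists_insertDescent_eq π hi hv h1 h2
          -- Deletion shifts only values above the deleted pair, and all entries before `i` lie
          -- below it.
          have hb : prefixBound π i = prefixBound σ i := by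
            refine prefixBound_congr _ _ (by omega) hi fun k hk => ?_
            have h3 := lt_prefixBound π (i := i) (k := ⟨k, by omega⟩) hk
            have h4 := insertDescent_of_lt σ hi hv hk
            rw [hσ] at h4
            split_ifs at h4 <;> omega
          refine ⟨σ, ?_⟩
          simp only [← hb]
          exact hσ
      · intro σ j hj
        simp only [HasTightDescentAt, prefixBound_insertDescent σ hi (show j ≤ i by omega),
          insertDescent_prefixBound_of_lt σ hi (show j < i by omega),
          insertDescent_prefixBound_of_lt σ hi (show j + 1 < i by omega)]
        constructor
        · rintro ⟨_, h⟩
          exact ⟨by omega, h⟩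
        · rintro ⟨_, h⟩
          exact ⟨by omega, h⟩) (n - 2) n (by omega)
  have hset : {π | ∀ i, 0 < i → ¬ HasTightDescentAt n π i} =
      {π | ∀ i, 1 ≤ i → i < 1 + (n - 2) → ¬ HasTightDescentAt n π i} := by
    ext π
    exact ⟨fun h i hi _ => h i hi, fun h i hi hP => h i hi (by have := hP.1; omega) hP⟩
  rw [hset, hmain]
  rcases n with _ | _ | n
  · simp [sparseSum_of_le_one]
  · simp [sparseSum_of_le_one]
  · simp

/-! ### Coefficients of the substituted series -/

section Series

open PowerSeries

/-- Comparing coefficients in `u ^ (m + 1) * (1 + X ^ 2) = u ^ m` gives Pascal's rule. At `m = 0`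
the truncated `j - 1` makes the binomial vanish for `j > 0`, as it should. -/
theorem coeff_inv_one_add_X_sq_pow (m j : ℕ) :
    coeff (2 * j) (((1 + X ^ 2)⁻¹ : PowerSeries ℚ) ^ m) = (-1) ^ j * ((m + j - 1).choose j : ℚ) ∧
      coeff (2 * j + 1) (((1 + X ^ 2)⁻¹ : PowerSeries ℚ) ^ m) = 0 := by
  set u : PowerSeries ℚ := (1 + X ^ 2)⁻¹ with hu
  have hmul : ∀ m, u ^ (m + 1) + u ^ (m + 1) * X ^ 2 = u ^ m := by
    intro m
    have : u * (1 + X ^ 2) = 1 := PowerSeries.inv_mul_cancel _ (by simp)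
    calc u ^ (m + 1) + u ^ (m + 1) * X ^ 2 = u ^ m * (u * (1 + X ^ 2)) := by ring
      _ = u ^ m := by rw [this, mul_one]
  induction m generalizing j with
  | zero =>
    rcases j with _ | j
    · simp [coeff_one]
    · simp [coeff_one]
  | succ m ihm =>
    induction j with
    | zero =>
      have h0 := congrArg (coeff 0) (hmul m)
      have h1 := congrArg (coeff 1) (hmul m)
      rw [map_add, coeff_mul_X_pow', if_neg (by norm_num), add_zero] at h0 h1
      have := ihm 0
      simp only [mul_zero, zero_add] at this ⊢
      rw [h0, h1]
      simpa using this
    | succ j ihj =>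
      have h0 := congrArg (coeff (2 * j + 2)) (hmul m)
      have h1 := congrArg (coeff (2 * j + 1 + 2)) (hmul m)
      rw [map_add, coeff_mul_X_pow] at h0 h1
      have h := ihm (j + 1)
      rw [show 2 * (j + 1) = 2 * j + 2 by ring] at h ⊢
      rw [show 2 * j + 2 + 1 = 2 * j + 1 + 2 by ring] at h ⊢
      rw [h.1, ihj.1] at h0
      rw [h.2, ihj.2] at h1
      constructor
      · rw [eq_sub_of_add_eq h0, show m + (j + 1) - 1 = m + j by omega,
          show m + 1 + j - 1 = m + j by omega, show m + 1 + (j + 1) - 1 = m + j + 1 by omega,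
          Nat.choose_succ_succ']
        push_cast
        ring
      · simpa using h1

theorem coeff_xDivOneAddSq_pow_of_lt {m n : ℕ} (h : n < m) : coeff n (xDivOneAddSq ^ m) = 0 := by
  rw [xDivOneAddSq, mul_pow, coeff_X_pow_mul', if_neg (by omega)]

theorem coeff_xDivOneAddSq_pow (m d : ℕ) :
    coeff (d + m) (xDivOneAddSq ^ m) = coeff d (((1 + X ^ 2)⁻¹ : PowerSeries ℚ) ^ m) := by
  rw [xDivOneAddSq, mul_pow, coeff_X_pow_mul]

theorem coeff_subst_factorialSeries (n : ℕ) :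
    coeff n (subst xDivOneAddSq factorialSeries) = (sparseSum n (n - 1) : ℚ) := by
  rw [PowerSeries.coeff_subst' hasSubst_xDivOneAddSq,
    finsum_eq_sum_of_support_subset (s := Finset.range (n + 1))]
  · rw [sparseSum]
    push_cast
    symm
    -- Only exponents `m` of the same parity as `n` contribute.
    refine Finset.sum_of_injOn (fun j => n - 2 * j) ?_ ?_ ?_ ?_
    · intro a ha b hb hab
      simp only [Finset.coe_range, Set.mem_Iio] at ha hb hab
      omega
    · intro a _
      simp only [Finset.coe_range, Set.mem_Iio]
      omega
    · intro m hm hm'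
      simp only [Finset.mem_range, Finset.coe_range, Set.mem_image, Set.mem_Iio, not_exists,
        not_and] at hm hm'
      rcases Nat.even_or_odd' (n - m) with ⟨j, hj | hj⟩
      · exact absurd (by omega) (hm' j (by omega))
      · obtain rfl : n = 2 * j + 1 + m := by omega
        rw [coeff_xDivOneAddSq_pow, (coeff_inv_one_add_X_sq_pow m j).2, smul_zero]
    · intro j hj
      simp only [Finset.mem_range] at hj
      obtain ⟨m, rfl⟩ : ∃ m, n = 2 * j + m := ⟨n - 2 * j, by omega⟩
      simp only [Nat.add_sub_cancel_left]
      rw [coeff_xDivOneAddSq_pow, (coeff_inv_one_add_X_sq_pow m j).1, factorialSeries, coeff_mk,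
        show 2 * j + m - 1 - j = m + j - 1 by omega, smul_eq_mul, mul_comm]
  · intro m hm
    simp only [Finset.coe_range, Set.mem_Iio]
    by_contra h
    exact hm (by simp only [coeff_xDivOneAddSq_pow_of_lt (show n < m by omega), smul_zero])

end Series

/-! ### From the mesh pattern to tight descents -/

theorem inBox_meshPatternP_iff {n : ℕ} (π : Equiv.Perm (Fin n)) (f : Fin 3 ↪o Fin n)
    (a b : Fin 4) (l : Fin n) : meshPatternP.InBox π f a b l ↔
      (((0 < a.val → f 0 < l) ∧ (a.val ≤ 0 → l < f 0)) ∧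
        ((1 < a.val → f 1 < l) ∧ (a.val ≤ 1 → l < f 1)) ∧
        ((2 < a.val → f 2 < l) ∧ (a.val ≤ 2 → l < f 2))) ∧
      (((0 < b.val → π (f 0) < π l) ∧ (b.val ≤ 0 → π l < π (f 0))) ∧
        ((2 < b.val → π (f 1) < π l) ∧ (b.val ≤ 2 → π l < π (f 1))) ∧
        ((1 < b.val → π (f 2) < π l) ∧ (b.val ≤ 1 → π l < π (f 2)))) := by
  have s0 : (Equiv.swap 1 2 : Equiv.Perm (Fin 3)) 0 = 0 := by decide
  simp [MeshPattern.InBox, meshPatternP, Fin.forall_fin_succ, s0]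

/-- The three closing conditions come from the boxes in columns `0` and `1`, the full column `2`,
and the two boxes of column `3`, respectively. -/
theorem isOccurrence_meshPatternP_iff {n : ℕ} (π : Equiv.Perm (Fin n)) (f : Fin 3 ↪o Fin n) :
    meshPatternP.IsOccurrence π f ↔ π (f 0) < π (f 2) ∧ π (f 2) < π (f 1) ∧
      (∀ l, l < f 1 → π l < π (f 2)) ∧ (∀ l, ¬ (f 1 < l ∧ l < f 2)) ∧
      ∀ l, f 2 < l → ¬ (π (f 0) < π l ∧ π l < π (f 1)) := by
  have h01 : f 0 < f 1 := f.strictMono (by decide)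
  have h12 : f 1 < f 2 := f.strictMono (by decide)
  have hne : ∀ l m, (π l).val = (π m).val → l.val = m.val := fun l m h =>
    congrArg _ (π.injective (Fin.ext h))
  constructor
  · rintro ⟨h, hs⟩
    have h02 : π (f 0) < π (f 2) := (h 0 2).2 (by decide)
    have h21 : π (f 2) < π (f 1) := (h 2 1).2 (by decide)
    simp only [inBox_meshPatternP_iff] at hs
    clear h
    simp only [meshPatternP, Finset.forall_mem_insert, Finset.mem_singleton, forall_eq] at hs
    obtain ⟨hs1, hs2, hs3, hs4, hs5, hs6, hs7, hs8, hs9, hs10⟩ := hs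
    simp only [Fin.lt_def] at *
    refine ⟨h02, h21, fun l hl => ?_, fun l hl => ?_, fun l hl hl' => ?_⟩
    · have m0 : l.val = (f 0).val → (π l).val = (π (f 0)).val := fun e => by rw [Fin.ext e]
      have n0 := hne l (f 0)
      have n1 := hne l (f 1)
      have n2 := hne l (f 2)
      have t1 := hs1 l
      have t2 := hs2 l
      have t3 := hs3 l
      have t4 := hs4 l
      clear hs1 hs2 hs3 hs4 hs5 hs6 hs7 hs8 hs9 hs10 hne
      simp at t1 t2 t3 t4
      omega
    · have n0 := hne l (f 0)
      have n1 := hne l (f 1)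
      have n2 := hne l (f 2)
      have t1 := hs5 l
      have t2 := hs6 l
      have t3 := hs7 l
      have t4 := hs8 l
      clear hs1 hs2 hs3 hs4 hs5 hs6 hs7 hs8 hs9 hs10 hne
      simp at t1 t2 t3 t4
      omega
    · have n2 := hne l (f 2)
      have t1 := hs9 l
      have t2 := hs10 l
      clear hs1 hs2 hs3 hs4 hs5 hs6 hs7 hs8 hs9 hs10 hne
      simp at t1 t2
      omega
  · rintro ⟨h02, h21, hl, hm, hr⟩
    refine ⟨?_, ?_⟩
    · have s0 : (Equiv.swap 1 2 : Equiv.Perm (Fin 3)) 0 = 0 := by decide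
      simp [Fin.forall_fin_succ, meshPatternP, s0, h02, h21, h02.trans h21, h02.le, h21.le,
        (h02.trans h21).le]
    · simp only [inBox_meshPatternP_iff]
      simp only [meshPatternP, Finset.forall_mem_insert, Finset.mem_singleton, forall_eq]
      simp only [Fin.lt_def] at *
      refine ⟨?_, ?_, ?_, ?_, ?_, ?_, ?_, ?_, ?_, ?_⟩ <;>
      · intro l h
        have t1 := hl l
        have t2 := hm l
        have t3 := hr l
        clear hl hm hr hne
        simp at h
        omega

theorem mem_avoiders_meshPatternP_iff {n : ℕ} (π : Equiv.Perm (Fin n)) :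
    π ∈ meshPatternP.avoiders n ↔ ∀ i, 0 < i → ¬ HasTightDescentAt n π i := by
  constructor
  · rintro h i hi ⟨hn, h1, h2⟩
    obtain ⟨k, hk, hv⟩ := exists_add_one_eq_prefixBound π hi (by omega)
    -- With the largest earlier entry as the `1`, the only value strictly between the `1` and the
    -- `3` is the `2` itself.
    have hmono : StrictMono ![k, ⟨i, by omega⟩, ⟨i + 1, hn⟩] := by
      simp [Fin.strictMono_iff_lt_succ, Fin.forall_fin_succ]
      exact hk
    refine h (OrderEmbedding.ofStrictMono _ hmono) ?_
    rw [isOccurrence_meshPatternP_iff]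
    simp only [OrderEmbedding.coe_ofStrictMono, Matrix.cons_val, Fin.lt_def]
    refine ⟨by omega, by omega, fun l hl => h2 ▸ lt_prefixBound π hl, fun l hl => by omega,
      fun l hl hl' => ?_⟩
    have : l = ⟨i + 1, hn⟩ := π.injective (Fin.ext (by omega))
    subst this
    exact lt_irrefl _ hl
  · intro h f hf
    obtain ⟨h02, h21, hl, hm, hr⟩ := (isOccurrence_meshPatternP_iff π f).1 hf
    have h01 : f 0 < f 1 := f.strictMono (by decide)
    have h12 : f 1 < f 2 := f.strictMono (by decide)
    have e2 : (f 2).val = (f 1).val + 1 := by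
      by_contra hne
      refine hm ⟨(f 1).val + 1, by omega⟩ ⟨?_, ?_⟩ <;> simp only [Fin.lt_def] at * <;> omega
    have hbefore : ∀ l, π (f 0) < π l → π l < π (f 1) → l = f 2 ∨ l < f 1 := by
      intro l hl1 hl2
      have hne : l ≠ f 1 := fun e => by simp [e] at hl2
      have : ¬ f 2 < l := fun h => hr l h ⟨hl1, hl2⟩
      simp only [Fin.lt_def, Fin.ext_iff, ne_eq] at *
      omega
    have hb : prefixBound π (f 1).val = (π (f 2)).val := by
      refine le_antisymm ((prefixBound_le_iff π).2 fun k hk => hl k hk) ?_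
      -- The value just below the `2` is the `1` or lies above it; either way it occurs before the
      -- `3`.
      obtain ⟨l, hl'⟩ := π.surjective ⟨(π (f 2)).val - 1, by omega⟩
      have hlv : (π l).val = (π (f 2)).val - 1 := by rw [hl']
      have hlt : l < f 1 := by
        by_cases e : l = f 0
        · exact e ▸ h01
        · have hne : (π l).val ≠ (π (f 0)).val := fun e' => e (π.injective (Fin.ext e'))
          rcases hbefore l (by simp only [Fin.lt_def] at *; omega)
            (by simp only [Fin.lt_def] at *; omega) with rfl | h'
          · simp only [Fin.lt_def] at *; omega
          · exact h'
      have := lt_prefixBound π (i := (f 1).val) hlt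
      omega
    refine h (f 1).val (by simp only [Fin.lt_def] at *; omega) ⟨by omega, ?_, ?_⟩
    · rw [hb]
      by_contra hne
      -- If the value just above the `2` were not the `3`, it would occur before the `3`, where
      -- every entry is below the `2`.
      obtain ⟨l, hl'⟩ := π.surjective ⟨(π (f 2)).val + 1, by simp only [Fin.lt_def] at *; omega⟩
      have hlv : (π l).val = (π (f 2)).val + 1 := by rw [hl']
      have hne' : (π (f 1)).val ≠ (π (f 2)).val + 1 := hne
      rcases hbefore l (by simp only [Fin.lt_def] at *; omega)
        (by simp only [Fin.lt_def] at *; omega) with rfl | h'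
      · omega
      · have := hl l h'
        simp only [Fin.lt_def] at *
        omega
    · rw [hb]
      congr 2
      exact Fin.ext e2.symm

theorem mainTheorem2 :
    (PowerSeries.mk fun n => ((meshPatternP.avoiders n).ncard : ℚ)) =
        PowerSeries.subst xDivOneAddSq factorialSeries ∧
    ∀ n : ℕ, 2 ≤ n →
      (meshPatternP.avoiders n).ncard =
        adjacentCycleCount 2 n 0 + adjacentCycleCount 2 (n - 2) 0 := by
  have hcard : ∀ n, ((meshPatternP.avoiders n).ncard : ℤ) = sparseSum n (n - 1) := by
    intro n
    rw [← ncard_not_hasTightDescentAt]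
    congr 2
    ext π
    exact mem_avoiders_meshPatternP_iff π
  constructor
  · ext n
    rw [coeff_subst_factorialSeries, PowerSeries.coeff_mk, ← hcard, Int.cast_natCast]
  · intro n hn
    obtain ⟨n, rfl⟩ : ∃ m, n = m + 2 := ⟨n - 2, by omega⟩
    have h1 := hcard (n + 2)
    have h2 := adjacentCycleCount_two_zero (n + 2)
    have h3 := adjacentCycleCount_two_zero n
    have h4 := sparseSum_succ n n
    simp only [Nat.add_sub_cancel, show n + 2 - 1 = n + 1 by omega] at h1 ⊢
    omega
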